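/- Let $G$ be a torsion-free abelian group, of arbitrary (finite or infinite) rank. Call a torsion-free abelian group completely decomposable if it is a direct sum of (any number of, possibly no) subgroups of rank $1$, and clipped if it has no direct summand of rank $1$. Suppose that $$G = A \oplus H = A' \oplus H'$$ where $A, A'$ are completely decomposable subgroups of $G$ and $H, H'$ are clipped subgroups of $G$. Then $A \cong A'$. -/

import Mathlib

universe u

/-- `A` is completely decomposable: it is the (internal) direct sum of a family, finite or
infinite and possibly empty, of subgroups of rank `1`. -/
def IsCompletelyDecomposable (A : Type u) [AddCommGroup A] : Prop :=
  ∃ (ι : Type u) (_ : DecidableEq ι) (X : ι → AddSubgroup A),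
    (∀ i, Module.rank ℤ (X i) = 1) ∧ DirectSum.IsInternal X

/-- `H` is clipped: it has no direct summand of rank `1`. -/
def IsClipped (H : Type u) [AddCommGroup H] : Prop :=
  ∀ X Y : AddSubgroup H, IsCompl X Y → Module.rank ℤ X ≠ 1

/-- The subgroups `A` and `H` of `G` form a Main Decomposition `G = A ⊕ H`. -/
structure IsMainDecomposition {G : Type u} [AddCommGroup G] (A H : AddSubgroup G) : Prop where
  isCompl : IsCompl A H
  completelyDecomposable : IsCompletelyDecomposable A
  clipped : IsClipped H

/-! For each rank-one group `X`, the number of summands isomorphic to `X` is the same on both sides.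
The ring `End X` consists of fractions and is a commutative principal ideal ring. Since `H'` is
clipped, no composite `X → H' → X` is invertible, and all of them lie in one maximal ideal `m`
(`IsClipped.exists_isMaximal_comp_mem`). A nonzero composite `X → Y j → X` forces `Y j ≅ X`. Hence
modulo `m` only the summands of type `X` remain, and the two transition matrices satisfy `c d = 1`
over the field `R ⧸ m`. The rows of `c` are therefore independent, which bounds one count by the
other (`mk_summands_le`). Symmetry gives equality, and matching summands class by class gives the
isomorphism. -/

open Module Cardinal

/-! ### Torsion-free groups of rank one and their endomorphism rings. -/

section RankOne

variable {X Y : Type u} [AddCommGroup X] [AddCommGroup Y]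

theorem nontrivial_of_rank_int_eq_one (hX : Module.rank ℤ X = 1) : Nontrivial X := by
  by_contra h
  rw [not_nontrivial_iff_subsingleton] at h
  rw [rank_subsingleton'] at hX
  exact zero_ne_one hX

variable [IsAddTorsionFree X] [IsAddTorsionFree Y]

/-- Any two elements of a torsion-free abelian group of rank one lie in a common cyclic
subgroup. -/
theorem exists_common_generator (hX : Module.rank ℤ X = 1) {x : X} (hx : x ≠ 0) (y : X) :
    ∃ (w : X) (a b : ℤ), IsCoprime a b ∧ x = a • w ∧ y = b • w := by
  have hdep : ¬ LinearIndependent ℤ ![x, y] := fun h => by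
    have := h.cardinal_lift_le_rank
    rw [hX] at this
    simp at this
  rw [LinearIndependent.pair_iff] at hdep
  push Not at hdep
  obtain ⟨s, t, hst, hne⟩ := hdep
  have ht : t ≠ 0 := by
    rintro rfl
    by_cases hs : s = 0
    · exact hne hs rfl
    · simp [hs, hx] at hst
  have hg : (Int.gcd s t : ℤ) ≠ 0 := by
    simp [Int.gcd_eq_zero_iff, ht]
  obtain ⟨s', hs'⟩ := Int.gcd_dvd_left s t
  obtain ⟨t', ht'⟩ := Int.gcd_dvd_right s t
  have hst' : s' • x + t' • y = 0 := by
    apply zsmul_right_injective hg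
    simp only [smul_add, smul_smul, ← hs', ← ht', hst, smul_zero]
  have hbez : s' * Int.gcdA s t + t' * Int.gcdB s t = 1 := by
    have := Int.gcd_eq_gcd_ab s t
    apply mul_left_cancel₀ hg
    calc _ = ((Int.gcd s t : ℤ) * s') * Int.gcdA s t
            + ((Int.gcd s t : ℤ) * t') * Int.gcdB s t := by ring
      _ = _ := by rw [← hs', ← ht', ← this, mul_one]
  set u := Int.gcdA s t
  set v := Int.gcdB s t
  have hy : t' • y = -(s' • x) := by rw [← add_eq_zero_iff_eq_neg, add_comm]; exact hst'
  have hx' : s' • x = -(t' • y) := by rw [hy, neg_neg]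
  -- Solves `x = t' w`, `y = -s' w`, using `s' x = -t' y` and `s' u + t' v = 1`.
  refine ⟨v • x - u • y, t', -s', ⟨v, -u, by linarith⟩, ?_, ?_⟩
  · calc x = (s' * u + t' * v) • x := by rw [hbez, one_smul]
      _ = u • (s' • x) + (t' * v) • x := by rw [add_smul, mul_comm s', mul_smul]
      _ = _ := by rw [hx']; module
  · calc y = (s' * u + t' * v) • y := by rw [hbez, one_smul]
      _ = v • (t' • y) + (s' * u) • y := by module
      _ = _ := by rw [hy]; module

/-- A homomorphism from a group of rank one to a torsion-free group that kills a nonzero element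
is zero. -/
theorem AddMonoidHom.eq_zero_of_rank_one {Z : Type*} [AddCommGroup Z] [IsAddTorsionFree Z]
    (hX : Module.rank ℤ X = 1) {x : X} (hx : x ≠ 0) (f : X →+ Z) (hf : f x = 0) : f = 0 := by
  ext y
  obtain ⟨w, a, b, -, rfl, rfl⟩ := exists_common_generator hX hx y
  have ha : a ≠ 0 := by rintro rfl; simp at hx
  rw [map_zsmul] at hf
  rw [map_zsmul, (smul_eq_zero_iff_right ha).1 hf]
  simp

theorem AddMonoidHom.injective_of_rank_one {Z : Type*} [AddCommGroup Z] [IsAddTorsionFree Z]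
    (hX : Module.rank ℤ X = 1) {f : X →+ Z} (hf : f ≠ 0) : Function.Injective f := by
  rw [injective_iff_map_eq_zero]
  intro x hx
  by_contra h
  exact hf (f.eq_zero_of_rank_one hX h hx)

/-- Every endomorphism of a torsion-free group of rank one is multiplication by a fraction. -/
theorem AddMonoid.End.exists_zsmul_eq_zsmul (hX : Module.rank ℤ X = 1) (φ : AddMonoid.End X) :
    ∃ a b : ℤ, IsCoprime a b ∧ a ≠ 0 ∧ ∀ x, a • φ x = b • x := by
  have := nontrivial_of_rank_int_eq_one hX
  obtain ⟨x, hx⟩ := exists_ne (0 : X)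
  obtain ⟨w, a, b, hab, hxw, hyw⟩ := exists_common_generator hX hx (φ x)
  refine ⟨a, b, hab, by rintro rfl; simp [hxw] at hx, fun y => ?_⟩
  let ψ : X →+ X := (zsmulAddGroupHom a).comp φ - zsmulAddGroupHom b
  have hψ : ψ = 0 := ψ.eq_zero_of_rank_one hX hx <| by
    change a • φ x - b • x = 0
    rw [hyw]
    conv_lhs => rw [hxw]
    rw [smul_comm, sub_self]
  have := DFunLike.congr_fun hψ y
  exact sub_eq_zero.1 this

theorem AddMonoid.End.mul_comm_of_rank_one (hX : Module.rank ℤ X = 1)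
    (φ ψ : AddMonoid.End X) : φ * ψ = ψ * φ := by
  obtain ⟨a, b, -, ha, h⟩ := exists_zsmul_eq_zsmul hX φ
  refine AddMonoidHom.ext fun x => ?_
  apply zsmul_right_injective ha
  change a • φ (ψ x) = a • ψ (φ x)
  rw [h, ← map_zsmul ψ a, h, map_zsmul]

/-- An ideal is generated by its integers: if `φ = b / a` in lowest terms lies in `I`, then so does
`b`, and `1 / a = u + v φ` is itself an endomorphism. -/
theorem AddMonoid.End.isPrincipalIdealRing_of_rank_one (hX : Module.rank ℤ X = 1) :
    IsPrincipalIdealRing (AddMonoid.End X) := by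
  refine ⟨fun I => ?_⟩
  obtain ⟨n, hn⟩ := (IsPrincipalIdealRing.principal
    (Ideal.comap (Int.castRingHom (AddMonoid.End X)) I)).principal
  have hmem (k : ℤ) : (k : AddMonoid.End X) ∈ I ↔ n ∣ k := by
    rw [← Ideal.mem_span_singleton, ← Ideal.submodule_span_eq, ← hn]; rfl
  refine ⟨(n : AddMonoid.End X), le_antisymm (fun φ hφ => ?_) ?_⟩
  · obtain ⟨a, b, ⟨u, v, huv⟩, ha, h⟩ := exists_zsmul_eq_zsmul hX φ
    have hab : (a : AddMonoid.End X) * φ = b := AddMonoidHom.ext fun x => by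
      change (a : AddMonoid.End X) (φ x) = (b : AddMonoid.End X) x
      simpa using h x
    have hb : n ∣ b := by
      rw [← hmem, ← hab]
      exact I.mul_mem_left _ hφ
    obtain ⟨c, rfl⟩ := hb
    refine Submodule.mem_span_singleton.2 ⟨(u + v * φ) * c, AddMonoidHom.ext fun x => ?_⟩
    have hx := h x
    have hφx : φ ((n * c) • x) = (n * c) • φ x := map_zsmul φ _ x
    have hadd (y : X) : (u + v * φ : AddMonoid.End X) y = u • y + v • φ y := by
      change (u : AddMonoid.End X) y + (v : AddMonoid.End X) (φ y) = _
      simp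
    calc ((u + v * φ) * c * n : AddMonoid.End X) x
        = u • ((n * c) • x) + v • φ ((n * c) • x) := by
          rw [← hadd, mul_smul, smul_comm n c]
          simp
      _ = (u * a + v * (n * c)) • φ x := by rw [hφx, ← hx]; module
      _ = φ x := by rw [huv, one_smul]
  · rw [Submodule.span_singleton_le_iff_mem, hmem]

/-- Commutativity depends on the rank hypothesis, so a separate type `R` carries the commutative
structure. -/
theorem AddMonoid.End.exists_ringEquiv_of_rank_one (hX : Module.rank ℤ X = 1) :
    ∃ (R : Type u) (_ : CommRing R) (_ : AddMonoid.End X ≃+* R), IsPrincipalIdealRing R := by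
  have h := AddMonoid.End.isPrincipalIdealRing_of_rank_one hX
  exact ⟨AddMonoid.End X,
    { (inferInstance : Ring (AddMonoid.End X)) with
      mul_comm := AddMonoid.End.mul_comm_of_rank_one hX }, RingEquiv.refl _, h⟩

/-- A subgroup of a torsion-free group `X` of rank one that contains a nonzero multiple of `X` is
itself a multiple of `X`. -/
theorem AddSubgroup.exists_mem_iff_eq_zsmul_of_rank_one (hX : Module.rank ℤ X = 1)
    (S : AddSubgroup X) {n : ℤ} (hn : n ≠ 0) (hS : ∀ x, n • x ∈ S) :
    ∃ d : ℤ, d ≠ 0 ∧ ∀ y, y ∈ S ↔ ∃ x, y = d • x := by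
  let D : Ideal ℤ :=
    { carrier := {d | ∀ x, d • x ∈ S}
      add_mem' := fun ha hb x => by rw [add_smul]; exact S.add_mem (ha x) (hb x)
      zero_mem' := fun x => by simp
      smul_mem' := fun c d hd x => by
        rw [smul_eq_mul, mul_smul]; exact S.zsmul_mem (hd x) c }
  obtain ⟨d, hd⟩ := (IsPrincipalIdealRing.principal D).principal
  have hD (k : ℤ) : (∀ x, k • x ∈ S) ↔ d ∣ k := by
    rw [← Ideal.mem_span_singleton, ← Ideal.submodule_span_eq, ← hd]; rfl
  refine ⟨d, ?_, fun y => ⟨fun hy => ?_, ?_⟩⟩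
  · rintro rfl
    exact hn (zero_dvd_iff.1 ((hD n).1 hS))
  · suffices ∃ e : ℤ, (∀ z, e • z ∈ S) ∧ ∃ x, y = e • x by
      obtain ⟨e, he, x, rfl⟩ := this
      obtain ⟨c, rfl⟩ := (hD e).1 he
      exact ⟨c • x, mul_smul _ _ _⟩
    classical
    -- The largest divisor `e` of `n` with `y ∈ e X` works: writing `y = e b w` and `n = e f`,
    -- maximality makes `b` and `f` coprime, so `e w` is a combination of `y` and `n w`.
    let P : ℕ → Prop := fun e => (e : ℤ) ∣ n ∧ ∃ x, y = (e : ℤ) • x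
    have hbound {e : ℕ} (he : P e) : e ≤ n.natAbs :=
      Nat.le_of_dvd (Int.natAbs_pos.2 hn) (Int.natCast_dvd.1 he.1)
    have hP1 : P 1 := ⟨by simp, y, by simp⟩
    obtain ⟨⟨f, hf⟩, x, hx⟩ := Nat.findGreatest_spec (P := P) (hbound hP1) hP1
    have hmax {e : ℕ} (he : P e) : e ≤ Nat.findGreatest P n.natAbs :=
      Nat.le_findGreatest (hbound he) he
    set e := Nat.findGreatest P n.natAbs
    have he : 0 < e := hmax hP1
    by_cases hx0 : x = 0
    · exact ⟨n, hS, 0, by simp [hx, hx0]⟩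
    refine ⟨e, fun z => ?_, x, hx⟩
    obtain ⟨w, b, a, -, rfl, rfl⟩ := exists_common_generator hX hx0 z
    have hf0 : f ≠ 0 := by rintro rfl; simp [hn] at hf
    have hg : Int.gcd b f = 1 := by
      have hPg : P (e * Int.gcd b f) := by
        obtain ⟨b', hb'⟩ := Int.gcd_dvd_left b f
        refine ⟨?_, b' • w, ?_⟩
        · rw [hf]; push_cast
          exact mul_dvd_mul_left _ (Int.gcd_dvd_right b f)
        · rw [hx, smul_smul, smul_smul]; push_cast
          rw [mul_assoc, ← hb']
      have h1 : Int.gcd b f ≤ 1 := by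
        have := hmax hPg
        exact Nat.le_of_mul_le_mul_left (by simpa using this) he
      have h2 : Int.gcd b f ≠ 0 := by simp [Int.gcd_eq_zero_iff, hf0]
      omega
    obtain ⟨s, t, hst⟩ := Int.isCoprime_iff_gcd_eq_one.2 hg
    have : (e : ℤ) • a • w = (a * s) • y + (a * t) • (n • w) := by
      rw [hx, hf]
      calc (e : ℤ) • a • w = (s * b + t * f) • (e : ℤ) • a • w := by rw [hst, one_smul]
        _ = _ := by module
    rw [this]
    exact S.add_mem (S.zsmul_mem hy _) (S.zsmul_mem (hS w) _)
  · rintro ⟨x, rfl⟩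
    exact (hD d).2 dvd_rfl x

/-- Two torsion-free groups of rank one are isomorphic as soon as there is a nonzero composite of
homomorphisms between them. -/
theorem nonempty_addEquiv_of_comp_ne_zero (hX : Module.rank ℤ X = 1) (hY : Module.rank ℤ Y = 1)
    (α : X →+ Y) (β : Y →+ X) (h : β.comp α ≠ 0) : Nonempty (Y ≃+ X) := by
  have hβ : Function.Injective β := by
    refine β.injective_of_rank_one hY ?_
    rintro rfl
    simp at h
  obtain ⟨a, b, -, ha, hab⟩ := AddMonoid.End.exists_zsmul_eq_zsmul hX (β.comp α)
  have hb : b ≠ 0 := by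
    rintro rfl
    refine h (AddMonoidHom.ext fun x => ?_)
    have := hab x
    rw [zero_smul] at this
    exact (smul_eq_zero_iff_right ha).1 this
  -- The image of `β` contains `b X`, so it equals some `d X`, a copy of `X`.
  obtain ⟨d, hd, hS⟩ := AddSubgroup.exists_mem_iff_eq_zsmul_of_rank_one hX β.range hb
    fun x => ⟨a • α x, by rw [map_zsmul]; exact hab x⟩
  let μ : X →+ X := zsmulAddGroupHom d
  have hμ : Function.Injective μ := zsmul_right_injective hd
  have hrange : β.range = μ.range := by
    ext y
    rw [hS]
    exact ⟨fun ⟨x, hx⟩ => ⟨x, hx.symm⟩, fun ⟨x, hx⟩ => ⟨x, hx.symm⟩⟩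
  exact ⟨(AddMonoidHom.ofInjective hβ).trans <|
    (AddEquiv.addSubgroupCongr hrange).trans (AddMonoidHom.ofInjective hμ).symm⟩

end RankOne

/-! ### Composites through a clipped group. -/

section Clipped

variable {X H : Type u} [AddCommGroup X] [AddCommGroup H]

/-- A homomorphism from a rank-one group into a clipped group has no retraction. -/
theorem IsClipped.comp_ne_id (hH : IsClipped H) (hX : Module.rank ℤ X = 1)
    (f : X →+ H) (g : H →+ X) : g.comp f ≠ AddMonoidHom.id X := by
  intro h
  have hgf (x : X) : g (f x) = x := DFunLike.congr_fun h x
  have hf : Function.Injective f := Function.LeftInverse.injective hgf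
  refine hH f.range g.ker ⟨?_, ?_⟩ ?_
  · rw [AddSubgroup.disjoint_def]
    rintro _ ⟨x, rfl⟩ hx
    rw [AddMonoidHom.mem_ker, hgf] at hx
    rw [hx, map_zero]
  · rw [codisjoint_iff, eq_top_iff]
    intro y _
    rw [← add_sub_cancel (f (g y)) y]
    refine AddSubgroup.add_mem_sup ⟨_, rfl⟩ ?_
    rw [AddMonoidHom.mem_ker, map_sub, hgf, sub_self]
  · rw [← hX]
    exact (AddMonoidHom.ofInjective hf).toIntLinearEquiv.rank_eq.symm

variable {R : Type*} [CommRing R] [IsPrincipalIdealRing R]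

/-- If the endomorphism ring of `X` is a commutative principal ideal ring, then some composite
`X → H → X` divides all other such composites. -/
theorem exists_comp_dvd_comp (e : AddMonoid.End X ≃+* R) :
    ∃ (f₀ : X →+ H) (g₀ : H →+ X), ∀ (f : X →+ H) (g : H →+ X),
      e (g₀.comp f₀) ∣ e (g.comp f) := by
  let B (f : X →+ H) (g : H →+ X) : R := e (g.comp f)
  have hB₁ (f f' g) : B (f + f') g = B f g + B f' g := by
    refine Eq.trans ?_ (map_add e _ _)
    exact congrArg e (AddMonoidHom.ext fun x => map_add g _ _)
  have hB₂ (f g g') : B f (g + g') = B f g + B f g' := e.map_add' (g.comp f) (g'.comp f)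
  have hB₃ (f g) (a : R) : B (f.comp (e.symm a)) g = B f g * a := by
    conv_rhs => rw [← e.apply_symm_apply a]
    exact e.map_mul' (g.comp f) (e.symm a)
  have hB₄ (f g) (a : R) : B f ((e.symm a : X →+ X).comp g) = B f g * a := by
    conv_rhs => rw [← e.apply_symm_apply a, mul_comm]
    exact e.map_mul' (e.symm a) (g.comp f)
  have hne : (Set.range fun p : (X →+ H) × (H →+ X) => Ideal.span {B p.1 p.2}).Nonempty :=
    Set.range_nonempty _
  -- The values of `B` need not be closed under addition, so a maximal principal ideal among those
  -- they generate is chosen.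
  obtain ⟨_, ⟨⟨f₀, g₀⟩, rfl⟩, hmax⟩ := set_has_maximal_iff_noetherian.2
    (inferInstance : IsNoetherian R R) _ hne
  have hdvd {f g} (h : B f g ∣ B f₀ g₀) : B f₀ g₀ ∣ B f g := by
    by_contra hn
    refine hmax _ ⟨(f, g), rfl⟩ (lt_of_le_not_ge ?_ ?_)
    · exact Ideal.span_singleton_le_span_singleton.2 h
    · exact fun h' => hn (Ideal.span_singleton_le_span_singleton.1 h')
  -- a linear combination of `B f₀ g₀` and `c` that is again a value of `B` is divisible
  have hgcd {c : R} (he : ∀ a b, ∃ f g, B f g = B f₀ g₀ * a + c * b) :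
      B f₀ g₀ ∣ c := by
    obtain ⟨d, hd⟩ := (IsPrincipalIdealRing.principal (Ideal.span {B f₀ g₀, c})).principal
    rw [Ideal.submodule_span_eq] at hd
    have hd₁ : d ∣ B f₀ g₀ := by
      rw [← Ideal.mem_span_singleton, ← hd]; exact Ideal.subset_span (by simp)
    have hd₂ : d ∣ c := by
      rw [← Ideal.mem_span_singleton, ← hd]; exact Ideal.subset_span (by simp)
    have hd₃ : d ∈ Ideal.span {B f₀ g₀, c} := by
      rw [hd]; exact Ideal.mem_span_singleton_self d
    obtain ⟨a, b, hab⟩ := Ideal.mem_span_pair.1 hd₃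
    obtain ⟨f, g, hfg⟩ := he a b
    have hfgd : B f g = d := by rw [hfg, ← hab, mul_comm a, mul_comm b]
    exact (hfgd ▸ hdvd (hfgd ▸ hd₁)).trans hd₂
  have h₁ (f) : B f₀ g₀ ∣ B f g₀ := hgcd fun a b =>
    ⟨f₀.comp (e.symm a) + f.comp (e.symm b), g₀, by rw [hB₁, hB₃, hB₃]⟩
  have h₂ (g) : B f₀ g₀ ∣ B f₀ g := hgcd fun a b =>
    ⟨f₀, (e.symm a : X →+ X).comp g₀ + (e.symm b : X →+ X).comp g, by rw [hB₂, hB₄, hB₄]⟩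
  refine ⟨f₀, g₀, fun f g => ?_⟩
  change B f₀ g₀ ∣ B f g
  obtain ⟨r, hr⟩ := h₁ f
  obtain ⟨s, hs⟩ := h₂ g
  -- remove the components along `f₀` and `g₀`
  let f' : X →+ H := f + f₀.comp (e.symm (-r))
  let g' : H →+ X := g + (e.symm (-s) : X →+ X).comp g₀
  have hf' : B f' g₀ = 0 := by rw [hB₁, hB₃, hr]; ring
  have hg' : B f₀ g' = 0 := by rw [hB₂, hB₄, hs]; ring
  -- The cross terms vanish, so this combination is a single value of `B`.
  have key : B f₀ g₀ ∣ B f' g' := hgcd fun a b =>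
    ⟨f₀.comp (e.symm a) + f'.comp (e.symm b), g₀ + g', by
      rw [hB₂, hB₁, hB₁, hB₃, hB₃, hB₃, hB₃, hf', hg']; ring⟩
  have hexp : B f' g' = B f g - B f₀ g₀ * (r * s) := by
    rw [hB₂, hB₄, hf', zero_mul, add_zero, hB₁, hB₃, hs]; ring
  rw [hexp] at key
  exact (dvd_sub_left (Dvd.intro _ rfl)).1 key

/-- For a clipped group `H` and a group `X` of rank one, all composites `X → H → X` lie in one
maximal ideal of the endomorphism ring of `X`. -/
theorem IsClipped.exists_isMaximal_comp_mem (e : AddMonoid.End X ≃+* R) (hH : IsClipped H)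
    (hX : Module.rank ℤ X = 1) :
    ∃ m : Ideal R, m.IsMaximal ∧ ∀ (f : X →+ H) (g : H →+ X), e (g.comp f) ∈ m := by
  obtain ⟨f₀, g₀, h₀⟩ := exists_comp_dvd_comp (H := H) e
  obtain ⟨m, hm, hle⟩ := Ideal.exists_le_maximal (Ideal.span {e (g₀.comp f₀)}) <| by
    rw [Ne, Ideal.span_singleton_eq_top]
    intro hu
    obtain ⟨a, ha⟩ := hu.exists_right_inv
    -- If the generator were a unit, its inverse would turn `f₀` into a section of `g₀`.
    refine hH.comp_ne_id hX (f₀.comp (e.symm a)) g₀ (e.injective ?_)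
    rw [← e.apply_symm_apply a] at ha
    exact (e.map_mul' _ _).trans (ha.trans (map_one e).symm)
  exact ⟨m, hm, fun f g => hle (Ideal.mem_span_singleton.2 (h₀ f g))⟩

end Clipped

/-! ### Counting summands modulo a maximal ideal. -/

section Comparison

open scoped DirectSum

/-- If a direct sum of groups of rank one is complemented by a clipped group, then it has at least
as many summands isomorphic to `X` as any other decomposition into a direct sum and a complement.
Modulo a suitable maximal ideal of the endomorphism ring of `X` the clipped group is invisible, and
the transition matrix has linearly independent rows. -/
theorem mk_summands_le {ι κ : Type u} {Z : ι → Type u} {Y : κ → Type u} {H H' X : Type u}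
    [∀ i, AddCommGroup (Z i)] [∀ j, AddCommGroup (Y j)] [∀ j, IsAddTorsionFree (Y j)]
    [AddCommGroup H] [AddCommGroup H'] [AddCommGroup X] [IsAddTorsionFree X]
    (hX : Module.rank ℤ X = 1) (hY : ∀ j, Module.rank ℤ (Y j) = 1) (hH' : IsClipped H')
    (E : (⨁ i, Z i) × H ≃+ (⨁ j, Y j) × H') :
    #{i // Nonempty (Z i ≃+ X)} ≤ #{j // Nonempty (Y j ≃+ X)} := by
  classical
  obtain ⟨R, _, e, _⟩ := AddMonoid.End.exists_ringEquiv_of_rank_one hX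
  obtain ⟨m, hm, hmem⟩ := hH'.exists_isMaximal_comp_mem e hX
  let _ : Field (R ⧸ m) := Ideal.Quotient.field m
  let q : AddMonoid.End X →+* R ⧸ m := (Ideal.Quotient.mk m).comp e
  let α (i : {i // Nonempty (Z i ≃+ X)}) : Z i ≃+ X := i.2.some
  let β (j : {j // Nonempty (Y j ≃+ X)}) : Y j ≃+ X := j.2.some
  have := nontrivial_of_rank_int_eq_one hX
  obtain ⟨x₀, hx₀⟩ := exists_ne (0 : X)
  let f (i : {i // Nonempty (Z i ≃+ X)}) : X →+ (⨁ j, Y j) × H' :=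
    E.toAddMonoidHom.comp <| (AddMonoidHom.inl _ H).comp <|
      (DirectSum.of Z i).comp (α i).symm.toAddMonoidHom
  let g (i : {i // Nonempty (Z i ≃+ X)}) : (⨁ j, Y j) × H' →+ X :=
    (α i).toAddMonoidHom.comp <| (DFinsupp.evalAddMonoidHom i.1).comp <|
      (AddMonoidHom.fst _ H).comp E.symm.toAddMonoidHom
  let φ (i i' : {i // Nonempty (Z i ≃+ X)}) : AddMonoid.End X := (g i').comp (f i)
  have hφ (i i' x) : φ i i' x = α i' ((DirectSum.of Z i ((α i).symm x)) i') := by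
    change α i' ((E.symm (E (_, _))).1 i'.1) = _
    rw [E.symm_apply_apply]
    rfl
  let c (i : {i // Nonempty (Z i ≃+ X)}) (j : {j // Nonempty (Y j ≃+ X)}) : AddMonoid.End X :=
    (β j).toAddMonoidHom.comp <| (DFinsupp.evalAddMonoidHom j.1).comp <|
      (AddMonoidHom.fst _ H').comp (f i)
  let d (i : {i // Nonempty (Z i ≃+ X)}) (j : {j // Nonempty (Y j ≃+ X)}) : AddMonoid.End X :=
    (g i).comp <| (AddMonoidHom.inl _ H').comp <|
      (DirectSum.of Y j).comp (β j).symm.toAddMonoidHom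
  -- Evaluation at `x₀` detects nonzero maps on `X`, so each row of `c` has finite support even when
  -- `κ` is infinite.
  let s (i : {i // Nonempty (Z i ≃+ X)}) : Finset κ := DFinsupp.support (f i x₀).1
  have hc {i j} (hj : j.1 ∉ s i) : c i j = 0 := by
    refine AddMonoidHom.eq_zero_of_rank_one hX hx₀ (c i j) ?_
    change β j ((f i x₀).1 j.1) = 0
    rw [DFinsupp.notMem_support_iff.1 hj, map_zero]
  let v (i : {i // Nonempty (Z i ≃+ X)}) : {j // Nonempty (Y j ≃+ X)} →₀ R ⧸ m :=
    Finsupp.onFinset ((s i).subtype _) (fun j => q (c i j)) fun j hj => by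
      rw [Finset.mem_subtype]
      by_contra h
      exact hj (by rw [hc h, map_zero])
  have key (i i') : Finsupp.linearCombination (R ⧸ m) (fun j => q (d i' j)) (v i) =
      q (φ i i') := by
    let T (j : κ) : AddMonoid.End X :=
      (((g i').comp (AddMonoidHom.inl _ H')).comp (DirectSum.of Y j)).comp
        ((DFinsupp.evalAddMonoidHom j).comp <| (AddMonoidHom.fst _ H').comp (f i))
    let h : AddMonoid.End X :=
      ((g i').comp (AddMonoidHom.inr _ H')).comp ((AddMonoidHom.snd _ H').comp (f i))
    have hT {j} (hj : ¬ Nonempty (Y j ≃+ X)) : T j = 0 := by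
      by_contra hne
      exact hj (nonempty_addEquiv_of_comp_ne_zero hX (hY j) _ _ hne)
    have hT' (j : {j // Nonempty (Y j ≃+ X)}) : T j = d i' j * c i j := by
      refine AddMonoidHom.ext fun x => ?_
      change g i' (DirectSum.of Y j ((f i x).1 j.1), 0) =
        g i' (DirectSum.of Y j ((β j).symm (β j ((f i x).1 j.1))), 0)
      rw [AddEquiv.symm_apply_apply]
    -- It is enough to compare both sides at `x₀`.
    have hsum : φ i i' = ∑ j ∈ s i, T j + h := by
      rw [← sub_eq_zero]
      refine AddMonoidHom.eq_zero_of_rank_one hX hx₀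
        (φ i i' - (∑ j ∈ s i, T j + h)) (sub_eq_zero.2 ?_)
      change g i' (f i x₀) = (∑ j ∈ s i, T j : X →+ X) x₀ + g i' (0, (f i x₀).2)
      have hx : (∑ j ∈ s i, T j : X →+ X) x₀ = g i' ((f i x₀).1, 0) := by
        rw [AddMonoidHom.finsetSum_apply]
        conv_rhs => rw [← DirectSum.sum_support_of (f i x₀).1]
        exact (map_sum ((g i').comp (AddMonoidHom.inl _ H')) _ _).symm
      rw [hx, ← map_add]
      simp
    have hqh : q h = 0 := Ideal.Quotient.eq_zero_iff_mem.2 (hmem _ _)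
    rw [hsum, map_add, hqh, add_zero, map_sum, Finsupp.linearCombination_apply,
      Finsupp.sum_of_support_subset _ Finsupp.support_onFinset_subset _ (by simp)]
    have : ∀ j ∈ s i, q (T j) ≠ 0 → Nonempty (Y j ≃+ X) := fun j _ hj => by
      by_contra hn
      exact hj (by rw [hT hn, map_zero])
    rw [← Finset.sum_filter_of_ne this, ← Finset.sum_subtype_eq_sum_filter]
    refine Finset.sum_congr rfl fun j _ => ?_
    rw [hT', map_mul, mul_comm]
    rfl
  have hv : LinearIndependent (R ⧸ m) v := by
    refine LinearIndependent.of_pairwise_dual_eq_zero_one v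
      (fun i => Finsupp.linearCombination (R ⧸ m) (fun j => q (d i j))) ?_ ?_
    · intro i' i hne
      rw [key]
      have : φ i i' = 0 := AddMonoidHom.ext fun x => by
        change φ i i' x = 0
        rw [hφ, DirectSum.of_eq_of_ne _ _ _ (fun h => hne (Subtype.ext h)), map_zero]
      rw [this, map_zero]
    · intro i
      rw [key]
      have : φ i i = 1 := AddMonoidHom.ext fun x => by
        change φ i i x = x
        rw [hφ, DirectSum.of_eq_same, AddEquiv.apply_symm_apply]
      rw [this, map_one]
  have := hv.cardinal_le_rank
  rwa [rank_finsupp_self, lift_id] at this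

/-- Summands of rank one can be counted up to isomorphism: families of rank-one groups that become
isomorphic after adding clipped complements have isomorphic direct sums. -/
theorem nonempty_directSum_addEquiv {ι κ : Type u} {Z : ι → Type u} {Y : κ → Type u} {H H' : Type u}
    [∀ i, AddCommGroup (Z i)] [∀ i, IsAddTorsionFree (Z i)]
    [∀ j, AddCommGroup (Y j)] [∀ j, IsAddTorsionFree (Y j)]
    [AddCommGroup H] [AddCommGroup H']
    (hZ : ∀ i, Module.rank ℤ (Z i) = 1) (hY : ∀ j, Module.rank ℤ (Y j) = 1)
    (hH : IsClipped H) (hH' : IsClipped H') (E : (⨁ i, Z i) × H ≃+ (⨁ j, Y j) × H') :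
    Nonempty ((⨁ i, Z i) ≃+ ⨁ j, Y j) := by
  classical
  have hcount (X : Type u) [AddCommGroup X] [IsAddTorsionFree X] (hX : Module.rank ℤ X = 1) :
      Nonempty ({i // Nonempty (Z i ≃+ X)} ≃ {j // Nonempty (Y j ≃+ X)}) :=
    Cardinal.eq.1 <| (mk_summands_le hX hY hH' E).antisymm (mk_summands_le hX hZ hH E.symm)
  -- the isomorphism classes of all the groups `Z i` and `Y j`
  let W : ι ⊕ κ → AddCommGrpCat.{u} :=
    Sum.elim (fun i => AddCommGrpCat.of (Z i)) fun j => AddCommGrpCat.of (Y j)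
  let r : Setoid (ι ⊕ κ) :=
    { r := fun a b => Nonempty (W a ≃+ W b)
      iseqv := ⟨fun _ => ⟨AddEquiv.refl _⟩, fun ⟨h⟩ => ⟨h.symm⟩, fun ⟨h⟩ ⟨h'⟩ => ⟨h.trans h'⟩⟩ }
  have hfib (C : Quotient r) : Nonempty
      ({i : ι // (Quotient.mk r (Sum.inl i)) = C} ≃ {j : κ // (Quotient.mk r (Sum.inr j)) = C}) := by
    induction C using Quotient.inductionOn with
    | h a =>
      simp only [Quotient.eq]
      cases a with
      | inl i => exact hcount (Z i) (hZ i)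
      | inr j => exact hcount (Y j) (hY j)
  -- Bijections between the fibres over each isomorphism class glue to one of the index sets.
  let σ : ι ≃ κ := Equiv.ofFiberEquiv fun C => (hfib C).some
  have hσ (i : ι) : Nonempty (Z i ≃+ Y (σ i)) :=
    Quotient.exact (Equiv.ofFiberEquiv_map (fun C => (hfib C).some) i).symm
  have hσ' (j : κ) : Nonempty (Z (σ.symm j) ≃+ Y j) := by
    have := hσ (σ.symm j)
    rwa [σ.apply_symm_apply] at this
  exact ⟨(DirectSum.equivCongrLeft σ).trans (DFinsupp.mapRange.addEquiv fun j => (hσ' j).some)⟩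

end Comparison

/-- The complementary summands of a group as factors of a direct product. -/
noncomputable def AddSubgroup.prodAddEquivOfIsCompl {G : Type*} [AddCommGroup G]
    (A H : AddSubgroup G) (h : IsCompl A H) : A × H ≃+ G :=
  (Submodule.prodEquivOfIsCompl A.toIntSubmodule H.toIntSubmodule
    (AddSubgroup.toIntSubmodule.isCompl h)).toAddEquiv

theorem theorem2p3 {G : Type u} [AddCommGroup G] [IsAddTorsionFree G]
    (A H A' H' : AddSubgroup G)
    (h : IsMainDecomposition A H) (h' : IsMainDecomposition A' H') :
    Nonempty (A ≃+ A') := by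
  obtain ⟨ι, _, Z, hZ, hZint⟩ := h.completelyDecomposable
  obtain ⟨κ, _, Y, hY, hYint⟩ := h'.completelyDecomposable
  let eZ := AddEquiv.ofBijective (DirectSum.coeAddMonoidHom Z) hZint
  let eY := AddEquiv.ofBijective (DirectSum.coeAddMonoidHom Y) hYint
  obtain ⟨e⟩ := nonempty_directSum_addEquiv hZ hY h.clipped h'.clipped <|
    (eZ.prodCongr (AddEquiv.refl H)).trans <|
      (A.prodAddEquivOfIsCompl H h.isCompl).trans <|
        (A'.prodAddEquivOfIsCompl H' h'.isCompl).symm.trans <|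
          (eY.prodCongr (AddEquiv.refl H')).symm
  exact ⟨eZ.symm.trans (e.trans eY)⟩
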